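/- Let $(c,d)\in\mathbb{Z}^2$ with $\gcd(c,d)=1$. Two pieces at positions $z,w\in\mathbb{Z}^2$ (possibly equal) attack each other if $w-z=r\,(c,d)$ for some $r\in\mathbb{Z}$; such pieces are called one-move riders with basic move $(c,d)$. For $q\ge 1$ and $n\ge 0$ let $u(q;n)$ be the number of placements of $q$ unlabelled pieces on the $n\times n$ board $\{1,\dots,n\}^2$ such that no two of them attack each other. A function $f:\mathbb{Z}_{\ge0}\to\mathbb{Z}$ is a quasipolynomial if there are an integer $p\ge1$ and polynomials $f_0,\dots,f_{p-1}\in\mathbb{Q}[x]$ with $f(n)=f_{n\bmod p}(n)$ for all $n$; the least such $p$ is its period. (1) If $q\ge2$, then $u(q;n)$ is a quasipolynomial function of $n$ with period exactly $\max(|c|,|d|)$. (2) For every $q\ge1$, $u(q;n)$ is a quasipolynomial function of $n$ whose period equals the denominator of the inside-out polytope that consists of the hypercube $([0,1]^2)^q$ and the hyperplanes $\{(z_1,\dots,z_q)\in(\mathbb{R}^2)^q : (z_j-z_i)\cdot(d,-c)=0\}$ for $i\ne j$. Here a vertex of the inside-out polytope is a point of the hypercube that is the unique point of an intersection of facet hyperplanes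 of the hypercube and hyperplanes of this arrangement; the denominator of a vertex $z$ is the least positive integer $N$ such that $Nz$ is integral; and the denominator of the inside-out polytope is the least common multiple of the denominators of its vertices. -/

import Mathlib

/-- Square `z` attacks square `w` under the one-move rider with basic move `m`: the difference
of the two locations is an integral multiple of `m` (the zero multiple included, so that two
pieces on the same square attack each other). -/
def Attacks (m z w : ℤ × ℤ) : Prop := ∃ r : ℤ, w - z = r • m

/-- The `n × n` square board: the integral points in the interior of `[0, n + 1]²`. -/
noncomputable def squareBoard (n : ℕ) : Finset (ℤ × ℤ) :=
  Finset.Icc (1 : ℤ) n ×ˢ Finset.Icc (1 : ℤ) n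

/-- A set of squares no two of which attack each other. -/
def IsNonattacking (m : ℤ × ℤ) (S : Finset (ℤ × ℤ)) : Prop :=
  ∀ z ∈ S, ∀ w ∈ S, z ≠ w → ¬ Attacks m z w

open Classical in
/-- `u(q; n)`: the number of nonattacking configurations of `q` unlabelled one-move riders with
basic move `m` on the `n × n` board. Two pieces on one square attack each other, so such a
configuration is a set of `q` squares, no two of which attack each other. -/
noncomputable def countNonattacking (m : ℤ × ℤ) (q n : ℕ) : ℕ :=
  (((squareBoard n).powersetCard q).filter (IsNonattacking m)).card

/-- `f` is given by a cyclically repeating sequence of `p` polynomials. -/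
def IsQuasipolynomialOfCycle (f : ℕ → ℕ) (p : ℕ) : Prop :=
  0 < p ∧ ∃ P : ℕ → Polynomial ℚ, ∀ n : ℕ, (f n : ℚ) = (P (n % p)).eval (n : ℚ)

/-- `f` is a quasipolynomial and its period, the shortest length of a cycle of constituents,
is `p`. -/
def IsQuasipolynomialOfPeriod (f : ℕ → ℕ) (p : ℕ) : Prop :=
  IsLeast {k : ℕ | IsQuasipolynomialOfCycle f k} p

/-- The hyperplanes spanned by the facets of the hypercube `([0,1]²)^q`. -/
def facetHyperplanes (q : ℕ) : Set (Set (Fin q → ℝ × ℝ)) :=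
  {H | ∃ i : Fin q, H = {z | (z i).1 = 0} ∨ H = {z | (z i).1 = 1} ∨
    H = {z | (z i).2 = 0} ∨ H = {z | (z i).2 = 1}}

/-- The move arrangement of `q` one-move riders with basic move `m = (c, d)`: the hyperplanes
`(z_j - z_i) · (d, -c) = 0` for `i ≠ j`. -/
def moveArrangement (m : ℤ × ℤ) (q : ℕ) : Set (Set (Fin q → ℝ × ℝ)) :=
  {H | ∃ i j : Fin q, i ≠ j ∧
    H = {z | ((z j).1 - (z i).1) * (m.2 : ℝ) + ((z j).2 - (z i).2) * (-(m.1 : ℝ)) = 0}}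

/-- A vertex of the inside-out polytope consisting of the hypercube `([0,1]²)^q` and the move
arrangement: a point of the hypercube that is the intersection of some facet hyperplanes and
some move hyperplanes. -/
def IsInsideOutVertex (m : ℤ × ℤ) (q : ℕ) (z : Fin q → ℝ × ℝ) : Prop :=
  (∀ i, (z i).1 ∈ Set.Icc (0 : ℝ) 1 ∧ (z i).2 ∈ Set.Icc (0 : ℝ) 1) ∧
    ∃ S : Set (Set (Fin q → ℝ × ℝ)), S ⊆ facetHyperplanes q ∪ moveArrangement m q ∧ ⋂₀ S = {z}

/-- `N` is the denominator of the point `z`: the least positive integer for which `N z` has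
integral coordinates. -/
def IsPointDenominator {q : ℕ} (z : Fin q → ℝ × ℝ) (N : ℕ) : Prop :=
  IsLeast {k : ℕ | 0 < k ∧
    ∀ i, ∃ a b : ℤ, (k : ℝ) * (z i).1 = (a : ℝ) ∧ (k : ℝ) * (z i).2 = (b : ℝ)} N

/-- `D` is the denominator of the inside-out polytope: the least positive common multiple of
the denominators of its vertices (each vertex having a denominator). -/
def IsInsideOutDenominator (m : ℤ × ℤ) (q D : ℕ) : Prop :=
  IsLeast {k : ℕ | 0 < k ∧
    ∀ z : Fin q → ℝ × ℝ, IsInsideOutVertex m q z → ∃ N : ℕ, IsPointDenominator z N ∧ N ∣ k} D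

/-!
Two pieces attack each other exactly when they are on the same line of direction `(c, d)`, i.e.
have the same value of `d * x - c * y` (`attacks_iff`). A nonattacking configuration is therefore a
choice of `q` lines and of one square on each, so `u(q; n)` is the `q`-th elementary symmetric
function of the lengths of the lines on the board (`countNonattacking_eq`), and by Newton's
identities a polynomial in the power sums of these lengths.

Let `a ≤ b` be the absolute values of `c` and `d`. A line of `ℓ` squares contains `ℓ - i` pairs
`z`, `z + i • (c, d)`, and the board contains `(n - i * a) * (n - i * b)` of them for `i ≤ n / b`,
none for larger `i`. Writing `ℓ ^ j` as a combination of truncated differences `ℓ - i` turns the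
`j`-th power sum into a sum over `0 ≤ i ≤ n / b` of a polynomial in `i` and `n`
(`sum_lineCard_pow`), hence into a quasipolynomial of cycle `b`.

That no shorter cycle exists is seen in the highest coefficient that depends on `r = n % b`. In
terms of `w = n - i * b`, which runs through an arithmetic progression from `r` to `n`, the
Bernoulli polynomials show that `r` enters the sum of `w ^ l` in the constant term only
(`progressionPoly`). It follows that the `j`-th power sum has degree at most `j + 1`, while its
constituents for `r` and for `0` differ in degree at most `j - 1`, and that for `j = 2` the
coefficients of `n` differ by `(b - a) * (r / b) * (1 - r / b)`. Newton's identities carry this to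
`u(q; n)`: the constituents differ in degree at most `2 * q - 3`, and in that degree by a nonzero
multiple of the same quantity (`newtonESymm_sub`). So the constituents for `0` and for `0 < r < b`
are distinct (`constituent_ne`), which a cycle of length `r` would forbid.

For the inside-out polytope, a vertex admits no displacement that stays in all hyperplanes through
it (`IsInsideOutVertex.displacement_eq_zero`). Hence every piece of a vertex is on a side of the
square and on a line through a corner of the square, and such a point has coordinates in
`(1 / b) ℤ`. Conversely a piece on a corner and one where the line through it meets the opposite
side give a vertex of denominator `b`, so that the denominator of the polytope is `b` for `q ≥ 2`;
for `q = 1` both the period and the denominator are `1`.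
-/

/-! ### Symmetric functions of the fibre sizes -/

open Finset in
/-- Newton's identities for the values of a function on a finite set. -/
theorem newton_powersetCard {ι : Type*} (U : Finset ι) (f : ι → ℚ) (q : ℕ) :
    ((q : ℚ) + 1) * ∑ T ∈ U.powersetCard (q + 1), ∏ t ∈ T, f t =
      ∑ j ∈ range (q + 1), (-1) ^ j * (∑ T ∈ U.powersetCard (q - j), ∏ t ∈ T, f t) *
        ∑ t ∈ U, f t ^ (j + 1) := by
  have he : ∀ k, MvPolynomial.aeval (fun t : U => f t) (MvPolynomial.esymm U ℚ k) =
      ∑ T ∈ U.powersetCard k, ∏ t ∈ T, f t := by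
    intro k
    rw [MvPolynomial.aeval_esymm_eq_multiset_esymm, ← Finset.esymm_map_val]
    congr 1
    exact Multiset.attach_map_val' U.val f
  have hp : ∀ k, MvPolynomial.aeval (fun t : U => f t) (MvPolynomial.psum U ℚ k) =
      ∑ t ∈ U, f t ^ k := by
    intro k
    simp [MvPolynomial.psum, Finset.sum_attach U (fun t => f t ^ k)]
  have h := congrArg (MvPolynomial.aeval (fun t : U => f t))
    (MvPolynomial.mul_esymm_eq_sum U ℚ (q + 1))
  rw [sum_filter, Finset.Nat.sum_antidiagonal_eq_sum_range_succ
    (fun a b => if a < q + 1 then (-1) ^ a * MvPolynomial.esymm U ℚ a * MvPolynomial.psum U ℚ b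
      else 0), Finset.sum_range_succ] at h
  simp only [map_mul, map_sum, map_pow, map_neg, map_one, map_natCast, he, hp,
    lt_irrefl, if_false, add_zero, map_zero, apply_ite (MvPolynomial.aeval (fun t : U => f t))] at h
  push_cast at h
  rw [h, mul_sum, ← Finset.sum_range_reflect]
  refine sum_congr rfl fun j hj => ?_
  have hj' : j ≤ q := by simpa [Nat.lt_succ_iff] using hj
  have e1 : q + 1 - 1 - j = q - j := by omega
  have e2 : q + 1 - (q - j) = j + 1 := by omega
  rw [e1, e2, if_pos (by omega)]
  have e3 : ((-1 : ℚ)) ^ (q + 1 + 1) * (-1) ^ (q - j) = (-1) ^ j := by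
    rw [← pow_add]
    obtain ⟨k, rfl⟩ := Nat.exists_eq_add_of_le hj'
    rw [show j + k + 1 + 1 + (j + k - j) = j + 2 * (k + 1) by omega, pow_add, pow_mul]
    simp
  rw [← e3]; ring

open Finset Classical in
/-- A set of `q` points with distinct `h`-values amounts to a set `T` of `q` values together with a
choice of one point in the fibre over each member of `T`. -/
theorem card_powersetCard_filter_injOn {α β : Type*} (s : Finset α) (h : α → β) (q : ℕ) :
    #((s.powersetCard q).filter fun S : Finset α => Set.InjOn h (S : Set α)) =
      ∑ T ∈ (s.image h).powersetCard q, ∏ t ∈ T, #{z ∈ s | h z = t} := by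
  have hmaps : ∀ S ∈ (s.powersetCard q).filter (fun S : Finset α => Set.InjOn h (S : Set α)),
      S.image h ∈ (s.image h).powersetCard q := by
    intro S hS
    simp only [mem_filter, mem_powersetCard] at hS ⊢
    exact ⟨image_subset_image hS.1.1, by rw [card_image_of_injOn hS.2, hS.1.2]⟩
  rw [card_eq_sum_card_fiberwise hmaps]
  refine sum_congr rfl fun T hT => ?_
  rw [mem_powersetCard] at hT
  rw [← card_pi]
  symm
  have key : ∀ g ∈ T.pi (fun t => {z ∈ s | h z = t}), ∀ t (ht : t ∈ T),
      g t ht ∈ s ∧ h (g t ht) = t := by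
    intro g hg t ht
    simpa using (mem_pi.1 hg) t ht
  refine card_bij (fun g _ => T.attach.image (fun t => g t.1 t.2)) ?_ ?_ ?_
  · intro g hg
    have hk := key g hg
    have hinj : Function.Injective (fun t : T => g t.1 t.2) := fun t t' e => by
      apply Subtype.ext
      rw [← (hk t.1 t.2).2, ← (hk t'.1 t'.2).2]
      exact congrArg h e
    simp only [mem_filter, mem_powersetCard]
    refine ⟨⟨⟨?_, ?_⟩, ?_⟩, ?_⟩
    · intro z hz
      obtain ⟨t, -, rfl⟩ := mem_image.1 hz
      exact (hk t.1 t.2).1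
    · rw [card_image_of_injective _ hinj, card_attach, hT.2]
    · intro z hz w hw e
      obtain ⟨t, -, rfl⟩ := mem_image.1 (mem_coe.1 hz)
      obtain ⟨t', -, rfl⟩ := mem_image.1 (mem_coe.1 hw)
      rw [(hk t.1 t.2).2, (hk t'.1 t'.2).2] at e
      rw [Subtype.ext e]
    · rw [image_image]
      ext t
      simp only [mem_image, mem_attach, true_and, Function.comp]
      constructor
      · rintro ⟨t', rfl⟩
        rw [(hk t'.1 t'.2).2]; exact t'.2
      · intro ht
        exact ⟨⟨t, ht⟩, (hk t ht).2⟩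
  · intro g hg g' hg' e
    funext t ht
    have : g t ht ∈ T.attach.image (fun t => g' t.1 t.2) := by
      rw [← e]; exact mem_image.2 ⟨⟨t, ht⟩, mem_attach _ _, rfl⟩
    obtain ⟨t', -, e'⟩ := mem_image.1 this
    have : t'.1 = t := by
      rw [← (key g' hg' t'.1 t'.2).2, ← (key g hg t ht).2]
      exact congrArg h e'
    subst this
    exact e'.symm
  · intro S hS
    simp only [mem_filter, mem_powersetCard] at hS
    obtain ⟨⟨⟨hSs, -⟩, hinj⟩, himg⟩ := hS
    have hch : ∀ t (_ : t ∈ T), ∃ z ∈ S, h z = t := by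
      intro t ht
      rw [← himg] at ht
      simpa using ht
    choose g hgS hgt using hch
    refine ⟨g, ?_, ?_⟩
    · rw [mem_pi]
      intro t ht
      simp [hSs (hgS t ht), hgt t ht]
    · ext z
      simp only [mem_image, mem_attach, true_and]
      constructor
      · rintro ⟨t, rfl⟩
        exact hgS _ _
      · intro hz
        have hzT : h z ∈ T := by rw [← himg]; exact mem_image_of_mem _ hz
        exact ⟨⟨h z, hzT⟩, hinj (hgS _ _) hz (hgt _ _)⟩

/-! ### The lines of the board -/

/-- The linear form `z ↦ z · (d, -c)`, constant exactly along the lines of direction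
`m = (c, d)`. -/
def lineForm (m z : ℤ × ℤ) : ℤ := m.2 * z.1 - m.1 * z.2

theorem attacks_iff {c d : ℤ} (hcd : IsCoprime c d) (z w : ℤ × ℤ) :
    Attacks (c, d) z w ↔ lineForm (c, d) z = lineForm (c, d) w := by
  unfold Attacks lineForm
  constructor
  · rintro ⟨r, hr⟩
    have h1 := congrArg Prod.fst hr
    have h2 := congrArg Prod.snd hr
    simp at h1 h2
    simp only
    linear_combination -d * h1 + c * h2
  · intro h
    simp only at h
    obtain ⟨a, b, hab⟩ := hcd
    refine ⟨a * (w.1 - z.1) + b * (w.2 - z.2), ?_⟩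
    ext
    · simp
      linear_combination (-(w.1 - z.1)) * hab - b * h
    · simp
      linear_combination (-(w.2 - z.2)) * hab + a * h

open Finset in
/-- The number of squares of the `n × n` board on the line `lineForm m = t`. -/
noncomputable def lineCard (m : ℤ × ℤ) (n : ℕ) (t : ℤ) : ℕ :=
  #{z ∈ squareBoard n | lineForm m z = t}

open Finset in
theorem countNonattacking_eq {c d : ℤ} (hcd : IsCoprime c d) (q n : ℕ) :
    countNonattacking (c, d) q n =
      ∑ T ∈ ((squareBoard n).image (lineForm (c, d))).powersetCard q,
        ∏ t ∈ T, lineCard (c, d) n t := by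
  classical
  have h := card_powersetCard_filter_injOn (squareBoard n) (lineForm (c, d)) q
  have e : ∀ S, IsNonattacking (c, d) S ↔ Set.InjOn (lineForm (c, d)) (S : Set (ℤ × ℤ)) := by
    intro S
    unfold IsNonattacking
    simp only [attacks_iff hcd]
    constructor
    · intro h z hz w hw e
      by_contra hne
      exact h z hz w hw hne e
    · intro h z hz w hw hne e
      exact hne (h hz hw e)
  unfold countNonattacking lineCard
  simp only [e]
  convert h

open Finset in
theorem card_Icc_inter_shift (n : ℕ) (k : ℤ) :
    #{x ∈ Icc (1 : ℤ) n | x + k ∈ Icc (1 : ℤ) n} = n - k.natAbs := by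
  have : {x ∈ Icc (1 : ℤ) n | x + k ∈ Icc (1 : ℤ) n} = Icc (max 1 (1 - k)) (min n (n - k)) := by
    ext x
    simp only [mem_filter, mem_Icc]
    omega
  rw [this, Int.card_Icc]
  omega

open Finset in
theorem card_board_inter_shift (c d : ℤ) (n i : ℕ) :
    #{z ∈ squareBoard n | z + (i : ℤ) • (c, d) ∈ squareBoard n} =
      (n - i * c.natAbs) * (n - i * d.natAbs) := by
  have : {z ∈ squareBoard n | z + (i : ℤ) • (c, d) ∈ squareBoard n} =
      {x ∈ Icc (1 : ℤ) n | x + i * c ∈ Icc (1 : ℤ) n} ×ˢ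
      {x ∈ Icc (1 : ℤ) n | x + i * d ∈ Icc (1 : ℤ) n} := by
    ext z
    simp only [squareBoard, mem_filter, mem_product, Prod.fst_add, Prod.snd_add, Prod.smul_fst,
      Prod.smul_snd, smul_eq_mul]
    tauto
  rw [this, card_product, card_Icc_inter_shift, card_Icc_inter_shift, Int.natAbs_mul,
    Int.natAbs_mul, Int.natAbs_natCast]

open Finset in
theorem card_inter_shift_of_ordConnected (A : Finset ℤ) (hA : (A : Set ℤ).OrdConnected) (i : ℕ) :
    #{r ∈ A | r + (i : ℤ) ∈ A} = #A - i := by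
  rcases A.eq_empty_or_nonempty with rfl | hne
  · simp
  · have hI : A = Icc (A.min' hne) (A.max' hne) := by
      ext r
      rw [mem_Icc]
      exact ⟨fun hr => ⟨A.min'_le r hr, A.le_max' r hr⟩,
        fun hr => hA.out (A.min'_mem hne) (A.max'_mem hne) hr⟩
    generalize A.min' hne = u at hI
    generalize A.max' hne = v at hI
    subst hI
    have : {r ∈ Icc u v | r + (i : ℤ) ∈ Icc u v} = Icc u (v - i) := by
      ext x
      simp only [mem_filter, mem_Icc]
      omega
    rw [this, Int.card_Icc, Int.card_Icc]
    omega

open Finset in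
/-- The squares of a line on the board form a chain `z₀, z₀ + m, …`, so that a line of `ℓ` squares
has `ℓ - i` (truncated) squares whose translate by `i • m` is on the board. -/
theorem card_line_inter_shift {c d : ℤ} (hcd : IsCoprime c d) (n i : ℕ) (t : ℤ) :
    #{z ∈ squareBoard n | z + (i : ℤ) • (c, d) ∈ squareBoard n ∧ lineForm (c, d) z = t} =
      lineCard (c, d) n t - i := by
  classical
  have hm : (c, d) ≠ (0 : ℤ × ℤ) := by
    intro h
    simp only [Prod.mk_eq_zero] at h
    rw [h.1, h.2] at hcd
    exact not_isCoprime_zero_zero hcd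
  rcases ({z ∈ squareBoard n | lineForm (c, d) z = t}).eq_empty_or_nonempty with h0 | ⟨z₀, hz₀⟩
  · rw [lineCard, h0, card_empty, Nat.zero_sub, card_eq_zero, ← subset_empty, ← h0]
    intro z hz
    simp only [mem_filter] at hz ⊢
    tauto
  · have hz₀t : lineForm (c, d) z₀ = t := (mem_filter.1 hz₀).2
    have hinj : Function.Injective (fun r : ℤ => z₀ + r • (c, d)) := fun r r' e =>
      smul_left_injective ℤ hm (add_left_cancel e)
    set A : Finset ℤ := (squareBoard n).preimage (fun r : ℤ => z₀ + r • (c, d)) hinj.injOn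
    have memA : ∀ r, r ∈ A ↔ z₀ + r • (c, d) ∈ squareBoard n := fun r => mem_preimage
    have hline : ∀ r : ℤ, lineForm (c, d) (z₀ + r • (c, d)) = t := by
      intro r
      rw [← hz₀t]
      simp [lineForm]; ring
    have hrep : ∀ z, lineForm (c, d) z = t → ∃ r : ℤ, z₀ + r • (c, d) = z := by
      intro z hz
      obtain ⟨r, hr⟩ := (attacks_iff hcd z₀ z).2 (hz₀t.trans hz.symm)
      exact ⟨r, by rw [← hr]; abel⟩
    have hA : (A : Set ℤ).OrdConnected := by
      refine ⟨fun r hr s hs x hx => ?_⟩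
      simp only [mem_coe, memA, squareBoard, mem_product, mem_Icc, Prod.fst_add, Prod.snd_add,
        Prod.smul_fst, Prod.smul_snd, smul_eq_mul] at hr hs ⊢
      obtain ⟨h1, h2⟩ := hx
      refine ⟨?_, ?_⟩
      · rcases le_total 0 c with h | h <;> constructor <;> nlinarith
      · rcases le_total 0 d with h | h <;> constructor <;> nlinarith
    have e1 : lineCard (c, d) n t = #A := by
      rw [lineCard, ← card_image_of_injective A hinj]
      congr 1
      ext z
      simp only [mem_filter, mem_image, memA]
      constructor
      · rintro ⟨hz, hzt⟩
        obtain ⟨r, rfl⟩ := hrep z hzt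
        exact ⟨r, hz, rfl⟩
      · rintro ⟨r, hr, rfl⟩
        exact ⟨hr, hline r⟩
    rw [e1, ← card_inter_shift_of_ordConnected A hA i, ← card_image_of_injective _ hinj]
    congr 1
    ext z
    simp only [mem_filter, mem_image, memA, add_smul, ← add_assoc]
    constructor
    · rintro ⟨hz, hz', hzt⟩
      obtain ⟨r, rfl⟩ := hrep z hzt
      exact ⟨r, ⟨hz, hz'⟩, rfl⟩
    · rintro ⟨r, ⟨hr, hr'⟩, rfl⟩
      exact ⟨hr, hr', hline r⟩

open Finset in
/-- Both sides count the squares `z` of the board for which `z + i • (c, d)` is on the board. -/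
theorem sum_lineCard_sub {c d : ℤ} (hcd : IsCoprime c d) (n i : ℕ) :
    ∑ t ∈ (squareBoard n).image (lineForm (c, d)), (lineCard (c, d) n t - i) =
      (n - i * c.natAbs) * (n - i * d.natAbs) := by
  rw [← card_board_inter_shift, card_eq_sum_card_fiberwise
    (f := lineForm (c, d)) (t := (squareBoard n).image (lineForm (c, d)))
    (fun z hz => mem_image_of_mem _ (mem_filter.1 hz).1)]
  refine sum_congr rfl fun t _ => ?_
  rw [← card_line_inter_shift hcd, filter_filter]

/-! ### Power sums of the line lengths -/

/-- The coefficient of the truncated difference `ℓ - i` in the expansion of `ℓ ^ j`, for `ℓ : ℕ` and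
`j ≥ 1`: the second difference of `x ↦ x ^ j` at `i`, except that for `i = 0` the power at `-1` is
replaced by `0`. -/
def powSecondDiff (j i : ℕ) : ℚ :=
  if i = 0 then 1 else ((i : ℚ) + 1) ^ j - 2 * (i : ℚ) ^ j + ((i : ℚ) - 1) ^ j

open Finset in
theorem sum_powSecondDiff {j : ℕ} (hj : 1 ≤ j) (l N : ℕ) (hl : l ≤ N) :
    ∑ i ∈ range N, powSecondDiff j i * ((l - i : ℕ) : ℚ) = (l : ℚ) ^ j := by
  have h1 : ∀ l : ℕ, ∑ i ∈ range (l + 1), powSecondDiff j i = ((l : ℚ) + 1) ^ j - (l : ℚ) ^ j := by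
    intro l
    induction l with
    | zero => simp [powSecondDiff, show j ≠ 0 by omega]
    | succ l ih =>
      rw [sum_range_succ, ih, powSecondDiff, if_neg (by omega)]
      push_cast
      ring
  have h2 : ∀ l : ℕ, ∑ i ∈ range l, powSecondDiff j i * ((l : ℚ) - i) = (l : ℚ) ^ j := by
    intro l
    induction l with
    | zero => simp [show j ≠ 0 by omega]
    | succ l ih =>
      have : ∑ i ∈ range (l + 1), powSecondDiff j i * (((l + 1 : ℕ) : ℚ) - i) =
          ∑ i ∈ range (l + 1), powSecondDiff j i * ((l : ℚ) - i) +
          ∑ i ∈ range (l + 1), powSecondDiff j i := by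
        rw [← sum_add_distrib]
        refine sum_congr rfl fun i _ => ?_
        push_cast; ring
      rw [this, h1, sum_range_succ, ih]
      push_cast; ring
  rw [← h2 l, ← sum_subset (range_subset_range.2 hl)]
  · refine sum_congr rfl fun i hi => ?_
    rw [Nat.cast_sub (mem_range.1 hi).le]
  · intro i _ hi
    rw [Nat.sub_eq_zero_of_le (by simpa using hi)]
    simp

open Finset in
/-- The `j`-th power sum of the lengths of the lines. With `b = max |c| |d|` the summand `i` counts
the pairs of squares `z`, `z + i • m` of the board, and there are none for `i > n / b`. -/
theorem sum_lineCard_pow {c d : ℤ} (hcd : IsCoprime c d) {j : ℕ} (hj : 1 ≤ j) (n : ℕ) :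
    ∑ t ∈ (squareBoard n).image (lineForm (c, d)), (lineCard (c, d) n t : ℚ) ^ j =
      ∑ i ∈ range (n / max c.natAbs d.natAbs + 1), powSecondDiff j i *
        (((n : ℚ) - i * (min c.natAbs d.natAbs : ℕ)) *
          ((n : ℚ) - i * (max c.natAbs d.natAbs : ℕ))) := by
  have hb : 0 < max c.natAbs d.natAbs := by
    by_contra h
    have hc : c = 0 := by omega
    have hd : d = 0 := by omega
    rw [hc, hd] at hcd
    exact not_isCoprime_zero_zero hcd
  set b := max c.natAbs d.natAbs with hbdef
  set a := min c.natAbs d.natAbs with hadef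
  have hab : a ≤ b := by omega
  have hprod : ∀ i, (n - i * c.natAbs) * (n - i * d.natAbs) = (n - i * a) * (n - i * b) := by
    intro i
    rcases le_total c.natAbs d.natAbs with h | h
    · rw [hadef, hbdef, min_eq_left h, max_eq_right h]
    · rw [hadef, hbdef, min_eq_right h, max_eq_left h, mul_comm]
  obtain ⟨N, hN1, hN2⟩ : ∃ N, (squareBoard n).card ≤ N ∧ n / b + 1 ≤ N :=
    ⟨_, le_max_left _ _, le_max_right _ _⟩
  calc _ = ∑ t ∈ (squareBoard n).image (lineForm (c, d)),
        ∑ i ∈ range N, powSecondDiff j i * ((lineCard (c, d) n t - i : ℕ) : ℚ) := by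
        refine sum_congr rfl fun t _ => ?_
        rw [sum_powSecondDiff hj]
        exact (card_filter_le _ _).trans hN1
    _ = ∑ i ∈ range N, powSecondDiff j i * (((n - i * a) * (n - i * b) : ℕ) : ℚ) := by
        rw [sum_comm]
        refine sum_congr rfl fun i _ => ?_
        rw [← mul_sum, ← hprod, ← sum_lineCard_sub hcd]
        push_cast
        rfl
    _ = _ := by
        rw [← sum_subset (range_subset_range.2 hN2)]
        · refine sum_congr rfl fun i hi => ?_
          have h1 : i * b ≤ n := by
            rw [mem_range, Nat.lt_succ_iff] at hi
            exact (Nat.le_div_iff_mul_le hb).1 hi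
          have h2 : i * a ≤ n := (Nat.mul_le_mul_left i hab).trans h1
          push_cast [Nat.cast_sub h1, Nat.cast_sub h2]
          ring
        · intro i _ hi
          rw [mem_range, not_lt, Nat.succ_le_iff, Nat.div_lt_iff_lt_mul hb] at hi
          rw [Nat.sub_eq_zero_of_le hi.le]
          simp

/-! ### Polynomials of bounded degree -/

open Polynomial in
theorem mul_mem_degreeLT {P R : ℚ[X]} {m s t : ℕ} (hP : P ∈ degreeLT ℚ m)
    (hR : R ∈ degreeLT ℚ (s + 1)) (h : m = 0 ∨ m + s ≤ t) : P * R ∈ degreeLT ℚ t := by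
  rcases eq_or_ne P 0 with rfl | hP0
  · simp
  rcases eq_or_ne R 0 with rfl | hR0
  · simp
  rw [mem_degreeLT, degree_eq_natDegree hP0, Nat.cast_lt] at hP
  rw [mem_degreeLT, degree_eq_natDegree hR0, Nat.cast_lt] at hR
  rw [mem_degreeLT, degree_eq_natDegree (mul_ne_zero hP0 hR0), Nat.cast_lt,
    natDegree_mul hP0 hR0]
  omega

open Polynomial in
theorem C_mul_mem_degreeLT {P : ℚ[X]} {m : ℕ} (x : ℚ) (hP : P ∈ degreeLT ℚ m) :
    C x * P ∈ degreeLT ℚ m := by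
  rw [← smul_eq_C_mul]
  exact Submodule.smul_mem _ _ hP

open Polynomial in
theorem X_mul_mem_degreeLT {P : ℚ[X]} {m : ℕ} (hP : P ∈ degreeLT ℚ m) :
    X * P ∈ degreeLT ℚ (m + 1) := by
  rw [mul_comm]
  refine mul_mem_degreeLT (s := 1) hP ?_ (Or.inr le_rfl)
  rw [mem_degreeLT, degree_X]
  exact_mod_cast one_lt_two

open Polynomial in
theorem coeff_eq_zero_of_mem_degreeLT {P : ℚ[X]} {m k : ℕ} (hP : P ∈ degreeLT ℚ m) (hk : m ≤ k) :
    P.coeff k = 0 :=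
  coeff_eq_zero_of_degree_lt ((mem_degreeLT.1 hP).trans_le (by exact_mod_cast hk))

/-! ### Constituents of the power sums -/

open Polynomial in
/-- The polynomial in `n` giving `∑ i ^ e * (n - i * d) ^ l`, over `0 ≤ i ≤ n / d`, for
`n ≡ r` modulo `d`. For `e = 0` this is a sum of `l`-th powers of an arithmetic progression of
difference `d` from `r` to `n`, in which the Bernoulli polynomials separate the upper end from the
lower one, so that `r` enters the constant term only; the power of `i` is then raised through
`d * i = n - (n - i * d)`. -/
noncomputable def progressionPoly (d : ℕ) : ℕ → ℕ → ℕ → ℚ[X]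
  | 0, l, r => C ((d : ℚ) ^ l / (l + 1)) *
      ((Polynomial.bernoulli (l + 1)).comp (1 + C (1 / (d : ℚ)) * X) -
        C ((Polynomial.bernoulli (l + 1)).eval ((r : ℚ) / d)))
  | e + 1, l, r => C (1 / (d : ℚ)) *
      (X * progressionPoly d e l r - progressionPoly d e (l + 1) r)

open Polynomial Finset in
theorem sum_add_pow_eq_bernoulli (l t : ℕ) (x : ℚ) :
    ((l : ℚ) + 1) * ∑ s ∈ range (t + 1), ((s : ℚ) + x) ^ l =
      (Polynomial.bernoulli (l + 1)).eval (1 + (t + x)) -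
        (Polynomial.bernoulli (l + 1)).eval x := by
  induction t with
  | zero =>
    rw [bernoulli_eval_one_add]
    simp
  | succ t ih =>
    have h := bernoulli_eval_one_add (l + 1) (1 + (t + x))
    rw [add_tsub_cancel_right] at h
    rw [sum_range_succ, mul_add, ih]
    push_cast at h ⊢
    rw [show (t : ℚ) + 1 + x = 1 + (t + x) by ring, h]
    ring

open Polynomial Finset in
theorem eval_progressionPoly {d : ℕ} (hd : 0 < d) (e l n : ℕ) :
    ∑ i ∈ range (n / d + 1), (i : ℚ) ^ e * ((n : ℚ) - i * d) ^ l =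
      (progressionPoly d e l (n % d)).eval (n : ℚ) := by
  have hd' : (d : ℚ) ≠ 0 := by positivity
  induction e generalizing l with
  | zero =>
    have hn : (n : ℚ) = d * (n / d : ℕ) + (n % d : ℕ) := by exact_mod_cast (Nat.div_add_mod n d).symm
    have hn' : (n : ℚ) / d = (n / d : ℕ) + ((n % d : ℕ) : ℚ) / d := by
      rw [div_eq_iff hd', add_mul, div_mul_cancel₀ _ hd']
      linear_combination hn
    simp only [progressionPoly, eval_mul, eval_C, eval_sub, eval_comp, eval_add, eval_one, eval_X]
    rw [one_div_mul_eq_div, hn', ← sum_add_pow_eq_bernoulli, ← sum_range_reflect, mul_sum, mul_sum]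
    refine sum_congr rfl fun i hi => ?_
    have hi' : i ≤ n / d := by simpa [Nat.lt_succ_iff] using hi
    rw [show n / d + 1 - 1 - i = n / d - i by omega, Nat.cast_sub hi', pow_zero, one_mul]
    have : (n : ℚ) - (((n / d : ℕ) : ℚ) - i) * d = d * (i + ((n % d : ℕ) : ℚ) / d) := by
      field_simp
      linear_combination hn
    rw [this, mul_pow]
    have : (l : ℚ) + 1 ≠ 0 := by positivity
    field_simp
  | succ e ih =>
    simp only [progressionPoly, eval_mul, eval_C, eval_sub, eval_X, ← ih]
    rw [mul_sum, ← sum_sub_distrib, mul_sum]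
    refine sum_congr rfl fun i _ => ?_
    field_simp
    ring

open Polynomial in
theorem progressionPoly_mem_degreeLT (d e l r : ℕ) :
    progressionPoly d e l r ∈ degreeLT ℚ (e + l + 2) := by
  induction e generalizing l with
  | zero =>
    refine C_mul_mem_degreeLT _ (Submodule.sub_mem _ ?_ ?_)
    · refine mem_degreeLT.2 (degree_le_natDegree.trans_lt ?_)
      have h1 : (Polynomial.bernoulli (l + 1)).natDegree ≤ l + 1 :=
        natDegree_le_iff_coeff_eq_zero.2 fun i hi => by
          rw [coeff_bernoulli, if_neg (not_le.2 hi)]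
      have h2 : (1 + C (1 / (d : ℚ)) * X : ℚ[X]).natDegree ≤ 1 := by compute_degree
      have h3 := natDegree_comp_le (p := Polynomial.bernoulli (l + 1))
        (q := 1 + C (1 / (d : ℚ)) * X)
      have h4 := h3.trans (Nat.mul_le_mul h1 h2)
      exact_mod_cast (by omega : _ < 0 + l + 2)
    · rw [mem_degreeLT]
      refine degree_C_le.trans_lt ?_
      exact_mod_cast (by omega : 0 < 0 + l + 2)
  | succ e ih =>
    refine C_mul_mem_degreeLT _ (Submodule.sub_mem _ ?_ ?_)
    · have := X_mul_mem_degreeLT (ih l)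
      rwa [show e + l + 2 + 1 = e + 1 + l + 2 by ring] at this
    · have := ih (l + 1)
      rwa [show e + (l + 1) + 2 = e + 1 + l + 2 by ring] at this

open Polynomial in
/-- The difference of two constituents has degree at most `e`. -/
theorem progressionPoly_sub_mem_degreeLT (d e l r : ℕ) :
    progressionPoly d e l r - progressionPoly d e l 0 ∈ degreeLT ℚ (e + 1) := by
  induction e generalizing l with
  | zero =>
    simp only [progressionPoly]
    rw [← mul_sub, sub_sub_sub_cancel_left, ← C_sub]
    refine C_mul_mem_degreeLT _ ?_
    rw [mem_degreeLT]
    refine degree_C_le.trans_lt ?_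
    exact_mod_cast (by omega : 0 < 0 + 1)
  | succ e ih =>
    simp only [progressionPoly]
    have h := Submodule.sub_mem _ (X_mul_mem_degreeLT (ih l))
      (degreeLT_mono (by omega : e + 1 ≤ e + 1 + 1) (ih (l + 1)))
    convert C_mul_mem_degreeLT (1 / (d : ℚ)) h using 1
    ring

open Polynomial in
/-- The polynomial in `n` giving `∑ i ^ e * (n - i * a) * (n - i * d)`, over `0 ≤ i ≤ n / d`, for
`n ≡ r` modulo `d`. -/
noncomputable def pairSumPoly (a d e r : ℕ) : ℚ[X] :=
  C (1 / (d : ℚ)) * (C ((d : ℚ) - a) * (X * progressionPoly d e 1 r) +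
    C (a : ℚ) * progressionPoly d e 2 r)

open Polynomial Finset in
theorem eval_pairSumPoly (a : ℕ) {d : ℕ} (hd : 0 < d) (e n : ℕ) :
    ∑ i ∈ range (n / d + 1), (i : ℚ) ^ e * (((n : ℚ) - i * a) * ((n : ℚ) - i * d)) =
      (pairSumPoly a d e (n % d)).eval (n : ℚ) := by
  have hd' : (d : ℚ) ≠ 0 := by positivity
  simp only [pairSumPoly, eval_mul, eval_add, eval_C, eval_X, ← eval_progressionPoly hd]
  rw [mul_sum, mul_sum, mul_sum, ← sum_add_distrib, mul_sum]
  refine sum_congr rfl fun i _ => ?_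
  field_simp
  ring

open Polynomial in
theorem pairSumPoly_mem_degreeLT (a d e r : ℕ) : pairSumPoly a d e r ∈ degreeLT ℚ (e + 4) := by
  refine C_mul_mem_degreeLT _ (Submodule.add_mem _ ?_ ?_)
  · exact C_mul_mem_degreeLT _ (X_mul_mem_degreeLT (progressionPoly_mem_degreeLT d e 1 r))
  · exact C_mul_mem_degreeLT _ (progressionPoly_mem_degreeLT d e 2 r)

open Polynomial in
theorem pairSumPoly_sub_mem_degreeLT (a d e r : ℕ) :
    pairSumPoly a d e r - pairSumPoly a d e 0 ∈ degreeLT ℚ (e + 2) := by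
  have h := Submodule.add_mem _
    (C_mul_mem_degreeLT ((d : ℚ) - a) (X_mul_mem_degreeLT
      (progressionPoly_sub_mem_degreeLT d e 1 r)))
    (C_mul_mem_degreeLT (a : ℚ) (degreeLT_mono (by omega : e + 1 ≤ e + 1 + 1)
      (progressionPoly_sub_mem_degreeLT d e 2 r)))
  convert C_mul_mem_degreeLT (1 / (d : ℚ)) h using 1
  simp only [pairSumPoly]
  ring

open Polynomial in
theorem coeff_one_pairSumPoly_sub (a : ℕ) {d : ℕ} (hd : 0 < d) (r : ℕ) :
    (pairSumPoly a d 0 r - pairSumPoly a d 0 0).coeff 1 =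
      ((d : ℚ) - a) / 2 * ((r : ℚ) / d * (1 - (r : ℚ) / d)) := by
  have hd' : (d : ℚ) ≠ 0 := by positivity
  have hB : ∀ x : ℚ, (Polynomial.bernoulli 2).eval x = x ^ 2 - x + (Polynomial.bernoulli 2).eval 0 := by
    intro x
    simp [Polynomial.bernoulli, Finset.sum_range_succ]
    ring
  have h1 : progressionPoly d 0 1 r - progressionPoly d 0 1 0 =
      C ((d : ℚ) / 2 * ((r : ℚ) / d * (1 - (r : ℚ) / d))) := by
    simp only [progressionPoly]
    rw [← mul_sub, sub_sub_sub_cancel_left, ← C_sub, ← C_mul, hB ((r : ℚ) / d)]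
    congr 1
    simp
    ring
  have h2 : (progressionPoly d 0 2 r - progressionPoly d 0 2 0).coeff 1 = 0 :=
    coeff_eq_zero_of_mem_degreeLT (progressionPoly_sub_mem_degreeLT d 0 2 r) le_rfl
  have : pairSumPoly a d 0 r - pairSumPoly a d 0 0 =
      C (1 / (d : ℚ)) * (C ((d : ℚ) - a) * (X * (progressionPoly d 0 1 r - progressionPoly d 0 1 0)) +
        C (a : ℚ) * (progressionPoly d 0 2 r - progressionPoly d 0 2 0)) := by
    simp only [pairSumPoly]; ring
  rw [this, h1, coeff_C_mul, coeff_add, coeff_C_mul, coeff_C_mul, h2, show (1 : ℕ) = 0 + 1 from rfl,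
    coeff_X_mul, coeff_C_zero]
  field_simp
  ring

open Polynomial in
/-- The constituent, on the residue class of `r` modulo `d`, of the `j`-th power sum of the lengths
of the lines. -/
noncomputable def powerSumPoly (a d j r : ℕ) : ℚ[X] :=
  ∑ k ∈ Finset.range (j - 1), C ((j.choose k : ℚ) * (1 + (-1) ^ (j - k))) * pairSumPoly a d k r -
    C ((-1) ^ j) * X ^ 2

open Finset in
theorem powSecondDiff_eq {j : ℕ} (hj : 1 ≤ j) (i : ℕ) :
    powSecondDiff j i =
      ∑ k ∈ range (j - 1), (j.choose k : ℚ) * (1 + (-1) ^ (j - k)) * (i : ℚ) ^ k -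
        if i = 0 then (-1) ^ j else 0 := by
  have h : ((i : ℚ) + 1) ^ j - 2 * (i : ℚ) ^ j + ((i : ℚ) - 1) ^ j =
      ∑ k ∈ range (j - 1), (j.choose k : ℚ) * (1 + (-1) ^ (j - k)) * (i : ℚ) ^ k := by
    obtain ⟨m, rfl⟩ := Nat.exists_eq_add_of_le' hj
    rw [sub_eq_add_neg (i : ℚ) 1, add_pow, add_pow, sum_range_succ, sum_range_succ, sum_range_succ,
      sum_range_succ, add_tsub_cancel_right]
    simp only [one_pow, mul_one, Nat.choose_self, Nat.sub_self, pow_zero, Nat.cast_one,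
      add_tsub_cancel_left, pow_one]
    have : ∑ k ∈ range m, ((m + 1).choose k : ℚ) * (1 + (-1) ^ (m + 1 - k)) * (i : ℚ) ^ k =
        ∑ k ∈ range m, (i : ℚ) ^ k * ((m + 1).choose k : ℚ) +
        ∑ k ∈ range m, (i : ℚ) ^ k * (-1) ^ (m + 1 - k) * ((m + 1).choose k : ℚ) := by
      rw [← sum_add_distrib]
      exact sum_congr rfl fun k _ => by ring
    rw [this]
    ring
  rw [powSecondDiff, ← h]
  split_ifs with hi
  · subst hi
    simp [show j ≠ 0 by omega]
  · ring

open Polynomial Finset in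
theorem eval_powerSumPoly (a : ℕ) {d : ℕ} (hd : 0 < d) {j : ℕ} (hj : 1 ≤ j) (n : ℕ) :
    ∑ i ∈ range (n / d + 1), powSecondDiff j i * (((n : ℚ) - i * a) * ((n : ℚ) - i * d)) =
      (powerSumPoly a d j (n % d)).eval (n : ℚ) := by
  simp only [powerSumPoly, eval_sub, eval_finsetSum, eval_mul, eval_C, eval_pow, eval_X,
    ← eval_pairSumPoly a hd]
  simp only [powSecondDiff_eq hj, sub_mul, sum_sub_distrib]
  congr 1
  · simp only [sum_mul, mul_sum]
    rw [sum_comm]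
    exact sum_congr rfl fun k _ => sum_congr rfl fun i _ => by ring
  · simp only [ite_mul, zero_mul]
    rw [sum_ite_eq' (range (n / d + 1)) 0]
    simp
    ring

open Polynomial in
theorem powerSumPoly_one (a d r : ℕ) : powerSumPoly a d 1 r = X ^ 2 := by
  simp [powerSumPoly]

open Polynomial in
theorem powerSumPoly_mem_degreeLT (a d : ℕ) {j : ℕ} (hj : 1 ≤ j) (r : ℕ) :
    powerSumPoly a d j r ∈ degreeLT ℚ (j + 2) := by
  refine Submodule.sub_mem _ (Submodule.sum_mem _ fun k hk => ?_) ?_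
  · rw [Finset.mem_range] at hk
    exact C_mul_mem_degreeLT _ (degreeLT_mono (by omega) (pairSumPoly_mem_degreeLT a d k r))
  · refine C_mul_mem_degreeLT _ ?_
    rw [mem_degreeLT, degree_X_pow]
    exact_mod_cast (by omega : 2 < j + 2)

open Polynomial in
theorem powerSumPoly_sub_mem_degreeLT (a d j r : ℕ) :
    powerSumPoly a d j r - powerSumPoly a d j 0 ∈ degreeLT ℚ j := by
  unfold powerSumPoly
  rw [sub_sub_sub_cancel_right, ← Finset.sum_sub_distrib]
  refine Submodule.sum_mem _ fun k hk => ?_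
  rw [Finset.mem_range] at hk
  rw [← mul_sub]
  exact C_mul_mem_degreeLT _ (degreeLT_mono (by omega) (pairSumPoly_sub_mem_degreeLT a d k r))

open Polynomial in
theorem coeff_one_powerSumPoly_two_sub (a : ℕ) {d : ℕ} (hd : 0 < d) (r : ℕ) :
    (powerSumPoly a d 2 r - powerSumPoly a d 2 0).coeff 1 =
      ((d : ℚ) - a) * ((r : ℚ) / d * (1 - (r : ℚ) / d)) := by
  unfold powerSumPoly
  rw [sub_sub_sub_cancel_right, ← Finset.sum_sub_distrib]
  simp only [← mul_sub]
  norm_num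
  rw [← coeff_sub, coeff_one_pairSumPoly_sub a hd]
  ring

/-! ### Elementary symmetric functions of quasipolynomial power sums -/

open Polynomial Finset in
/-- The sequence of elementary symmetric functions belonging to the power sums `p 1, p 2, …`,
computed by Newton's identities. -/
noncomputable def newtonESymm (p : ℕ → ℚ[X]) : ℕ → ℚ[X]
  | 0 => 1
  | q + 1 => C (1 / ((q : ℚ) + 1)) *
      ∑ j : Fin (q + 1), (-1) ^ (j : ℕ) * newtonESymm p (q - j) * p (j + 1)
decreasing_by omega

open Polynomial Finset in
theorem newtonESymm_succ (p : ℕ → ℚ[X]) (q : ℕ) :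
    newtonESymm p (q + 1) = C (1 / ((q : ℚ) + 1)) *
      ∑ j ∈ range (q + 1), (-1) ^ j * newtonESymm p (q - j) * p (j + 1) := by
  rw [newtonESymm, ← Fin.sum_univ_eq_sum_range
    (fun j => (-1) ^ j * newtonESymm p (q - j) * p (j + 1))]

open Polynomial in
theorem newtonESymm_zero (p : ℕ → ℚ[X]) : newtonESymm p 0 = 1 := by
  rw [newtonESymm]

open Polynomial in
theorem newtonESymm_one (p : ℕ → ℚ[X]) : newtonESymm p 1 = p 1 := by
  simp [newtonESymm_succ, newtonESymm_zero]

open Polynomial in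
theorem newtonESymm_mem_degreeLT {p : ℕ → ℚ[X]} (hp : ∀ j, 1 ≤ j → p j ∈ degreeLT ℚ (j + 2))
    (q : ℕ) : newtonESymm p q ∈ degreeLT ℚ (2 * q + 1) := by
  induction q using Nat.strong_induction_on with
  | _ q ih =>
    cases q with
    | zero =>
      rw [newtonESymm_zero, mem_degreeLT, degree_one]
      norm_num
    | succ q =>
      rw [newtonESymm_succ]
      refine C_mul_mem_degreeLT _ (Submodule.sum_mem _ fun j hj => ?_)
      rw [Finset.mem_range] at hj
      rw [mul_assoc, ← C_1, ← C_neg, ← C_pow]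
      exact C_mul_mem_degreeLT _ (mul_mem_degreeLT (s := j + 2) (ih _ (by omega))
        (hp (j + 1) (by omega)) (by omega))

open Polynomial in
theorem coeff_newtonESymm {p : ℕ → ℚ[X]} (hp1 : p 1 = X ^ 2)
    (hp : ∀ j, 1 ≤ j → p j ∈ degreeLT ℚ (j + 2)) (q : ℕ) :
    (newtonESymm p q).coeff (2 * q) = 1 / (q.factorial : ℚ) := by
  induction q with
  | zero => simp [newtonESymm_zero]
  | succ q ih =>
    rw [newtonESymm_succ, coeff_C_mul, Finset.sum_range_succ', coeff_add]
    have h0 : (∑ j ∈ Finset.range q, (-1) ^ (j + 1) * newtonESymm p (q - (j + 1)) *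
        p (j + 1 + 1)) ∈ degreeLT ℚ (2 * q + 2) := by
      refine Submodule.sum_mem _ fun j hj => ?_
      rw [Finset.mem_range] at hj
      rw [mul_assoc, ← C_1, ← C_neg, ← C_pow]
      exact C_mul_mem_degreeLT _ (mul_mem_degreeLT (s := j + 3) (newtonESymm_mem_degreeLT hp _)
        (hp (j + 2) (by omega)) (by omega))
    rw [coeff_eq_zero_of_mem_degreeLT h0 (by omega), pow_zero, one_mul, Nat.sub_zero, hp1,
      show 2 * (q + 1) = 2 * q + 2 by ring, coeff_mul_X_pow, ih, Nat.factorial_succ]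
    push_cast
    have := Nat.factorial_ne_zero q
    field_simp
    ring

open Polynomial in
/-- The first two terms of Newton's identity, and a remainder in terms of `p 3, p 4, …`. -/
theorem newtonESymm_add_two {p : ℕ → ℚ[X]} (hp1 : p 1 = X ^ 2) (q : ℕ) :
    newtonESymm p (q + 2) = C (1 / ((q : ℚ) + 2)) *
      (newtonESymm p (q + 1) * X ^ 2 - newtonESymm p q * p 2 +
        ∑ j ∈ Finset.range q, C ((-1) ^ j) * (newtonESymm p (q - 1 - j) * p (j + 3))) := by
  rw [newtonESymm_succ, Finset.sum_range_succ', Finset.sum_range_succ']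
  have : ∀ j, q + 1 - (j + 1 + 1) = q - 1 - j := by omega
  simp only [this, zero_add, Nat.sub_zero, hp1, add_tsub_cancel_right]
  have e : ((q + 1 : ℕ) : ℚ) + 1 = q + 2 := by push_cast; ring
  rw [e]
  congr 1
  have : ∑ j ∈ Finset.range q, (-1) ^ (j + 1 + 1) * newtonESymm p (q - 1 - j) * p (j + 1 + 1 + 1) =
      ∑ j ∈ Finset.range q, C ((-1) ^ j) * (newtonESymm p (q - 1 - j) * p (j + 3)) := by
    refine Finset.sum_congr rfl fun j _ => ?_
    simp only [C_pow, C_neg, C_1]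
    ring
  rw [this]
  norm_num
  ring

open Polynomial in
/-- If two sequences of power sums have the degrees of `powerSumPoly` and differ as its constituents
do, their elementary symmetric functions differ only below degree `2 * q - 2`, and in degree `2 * q - 3`
the difference comes from the term `-p 1 ^ (q - 2) * p 2 / (2 * (q - 2)!)` alone. -/
theorem newtonESymm_sub {p p' : ℕ → ℚ[X]} (hp1 : p 1 = X ^ 2) (hp1' : p' 1 = X ^ 2)
    (hp : ∀ j, 1 ≤ j → p j ∈ degreeLT ℚ (j + 2)) (hp' : ∀ j, 1 ≤ j → p' j ∈ degreeLT ℚ (j + 2))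
    (hsub : ∀ j, p j - p' j ∈ degreeLT ℚ j) (q : ℕ) :
    newtonESymm p q - newtonESymm p' q ∈ degreeLT ℚ (2 * q - 2) ∧
      ∀ m, q = m + 2 → (newtonESymm p q - newtonESymm p' q).coeff (2 * m + 1) =
        -(p 2 - p' 2).coeff 1 / (2 * (m.factorial : ℚ)) := by
  induction q using Nat.strong_induction_on with
  | _ q ih =>
    match q, ih with
    | 0, _ => simp [newtonESymm_zero]
    | 1, _ => simp [newtonESymm_one, hp1, hp1']
    | q + 2, ih =>
      have hX : (X ^ 2 : ℚ[X]) ∈ degreeLT ℚ (2 + 1) := by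
        rw [mem_degreeLT, degree_X_pow]
        norm_num
      set R : ℚ[X] := ∑ j ∈ Finset.range q, C ((-1) ^ j) *
        (newtonESymm p (q - 1 - j) * (p (j + 3) - p' (j + 3)) +
          (newtonESymm p (q - 1 - j) - newtonESymm p' (q - 1 - j)) * p' (j + 3)) with hR
      have e : newtonESymm p (q + 2) - newtonESymm p' (q + 2) = C (1 / ((q : ℚ) + 2)) *
          ((newtonESymm p (q + 1) - newtonESymm p' (q + 1)) * X ^ 2 -
            (p 2 - p' 2) * newtonESymm p q -
            (newtonESymm p q - newtonESymm p' q) * p' 2 + R) := by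
        have : R = ∑ j ∈ Finset.range q, C ((-1) ^ j) * (newtonESymm p (q - 1 - j) * p (j + 3)) -
            ∑ j ∈ Finset.range q, C ((-1) ^ j) * (newtonESymm p' (q - 1 - j) * p' (j + 3)) := by
          rw [hR, ← Finset.sum_sub_distrib]
          exact Finset.sum_congr rfl fun j _ => by ring
        rw [newtonESymm_add_two hp1, newtonESymm_add_two hp1', this]
        ring
      have hRmem : R ∈ degreeLT ℚ (2 * q + 1) := by
        refine Submodule.sum_mem _ fun j hj => C_mul_mem_degreeLT _ (Submodule.add_mem _ ?_ ?_)
        all_goals rw [Finset.mem_range] at hj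
        · rw [mul_comm (newtonESymm p _)]
          exact mul_mem_degreeLT (m := j + 3) (s := 2 * (q - 1 - j)) (hsub (j + 3))
            (newtonESymm_mem_degreeLT hp (q - 1 - j)) (by omega)
        · exact mul_mem_degreeLT (m := 2 * (q - 1 - j) - 2) (s := j + 4) (ih (q - 1 - j) (by omega)).1
            (hp' (j + 3) (by omega))
            (by omega)
      have h2 : (newtonESymm p q - newtonESymm p' q) * p' 2 ∈ degreeLT ℚ (2 * q + 1) :=
        mul_mem_degreeLT (m := 2 * q - 2) (s := 3) (ih q (by omega)).1 (hp' 2 (by omega)) (by omega)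
      rw [e]
      refine ⟨?_, ?_⟩
      · refine C_mul_mem_degreeLT _ (Submodule.add_mem _ (Submodule.sub_mem _
          (Submodule.sub_mem _ ?_ ?_) ?_) ?_)
        · exact mul_mem_degreeLT (m := 2 * (q + 1) - 2) (s := 2) (ih (q + 1) (by omega)).1 hX (by omega)
        · exact mul_mem_degreeLT (m := 2) (s := 2 * q) (hsub 2) (newtonESymm_mem_degreeLT hp q)
            (by omega)
        · exact degreeLT_mono (by omega) h2
        · exact degreeLT_mono (by omega) hRmem
      · intro m hm
        obtain rfl : q = m := by omega
        rw [coeff_C_mul, coeff_add, coeff_sub, coeff_sub,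
          coeff_eq_zero_of_mem_degreeLT h2 le_rfl, coeff_eq_zero_of_mem_degreeLT hRmem le_rfl]
        have h3 : ((p 2 - p' 2) * newtonESymm p q).coeff (2 * q + 1) =
            (p 2 - p' 2).coeff 1 * (1 / (q.factorial : ℚ)) := by
          rw [← coeff_newtonESymm hp1 hp q, add_comm]
          refine coeff_mul_add_eq_of_natDegree_le ?_ ?_
          · refine natDegree_le_of_degree_le (Order.le_of_lt_succ ?_)
            exact_mod_cast mem_degreeLT.1 (hsub 2)
          · refine natDegree_le_of_degree_le (Order.le_of_lt_succ ?_)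
            exact_mod_cast mem_degreeLT.1 (newtonESymm_mem_degreeLT hp q)
        rw [h3]
        cases q with
        | zero =>
          simp [newtonESymm_one, hp1, hp1']
          ring
        | succ m =>
          rw [show 2 * (m + 1) + 1 = 2 * m + 1 + 2 by ring, coeff_mul_X_pow,
            (ih (m + 1 + 1) (by omega)).2 m rfl, Nat.factorial_succ]
          have := Nat.factorial_ne_zero m
          push_cast
          field_simp
          ring

/-! ### The counting function and its period -/

/-- The constituents of `n ↦ u(q; n)` for `a = min |c| |d|` and `b = max |c| |d|`. -/
noncomputable def constituent (a b q r : ℕ) : Polynomial ℚ :=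
  newtonESymm (fun j => powerSumPoly a b j r) q

theorem max_natAbs_pos {c d : ℤ} (hcd : IsCoprime c d) : 0 < max c.natAbs d.natAbs := by
  by_contra h
  have hc : c = 0 := by omega
  have hd : d = 0 := by omega
  rw [hc, hd] at hcd
  exact not_isCoprime_zero_zero hcd

open Finset in
theorem countNonattacking_eq_eval {c d : ℤ} (hcd : IsCoprime c d) (q n : ℕ) :
    (countNonattacking (c, d) q n : ℚ) =
      (constituent (min c.natAbs d.natAbs) (max c.natAbs d.natAbs) q
        (n % max c.natAbs d.natAbs)).eval (n : ℚ) := by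
  have hb := max_natAbs_pos hcd
  rw [countNonattacking_eq hcd]
  push_cast
  unfold constituent
  induction q using Nat.strong_induction_on with
  | _ q ih =>
    cases q with
    | zero => simp [newtonESymm_zero]
    | succ q =>
      have h := newton_powersetCard ((squareBoard n).image (lineForm (c, d)))
        (fun t => (lineCard (c, d) n t : ℚ)) q
      have hq : (q : ℚ) + 1 ≠ 0 := by positivity
      rw [newtonESymm_succ, Polynomial.eval_mul, Polynomial.eval_C, Polynomial.eval_finsetSum,
        one_div, eq_inv_mul_iff_mul_eq₀ hq, h]
      refine sum_congr rfl fun j hj => ?_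
      rw [sum_lineCard_pow hcd (by omega), eval_powerSumPoly _ hb (by omega), ih _ (by omega)]
      simp

theorem isQuasipolynomialOfCycle_max {c d : ℤ} (hcd : IsCoprime c d) (q : ℕ) :
    IsQuasipolynomialOfCycle (fun n => countNonattacking (c, d) q n)
      (max c.natAbs d.natAbs) :=
  ⟨max_natAbs_pos hcd, _, fun n => countNonattacking_eq_eval hcd q n⟩

/-- The coefficients of degree `2 * q - 3` differ by a nonzero multiple of `r / b * (1 - r / b)`. -/
theorem constituent_ne {a b q r : ℕ} (hab : a < b) (hq : 2 ≤ q) (hr0 : 0 < r) (hr : r < b) :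
    constituent a b q r ≠ constituent a b q 0 := by
  intro h
  -- With `q = m + 2`, the coefficients of `X ^ (2 * m + 1)` are compared.
  obtain ⟨m, rfl⟩ := Nat.exists_eq_add_of_le' hq
  have key := (newtonESymm_sub (powerSumPoly_one a b r) (powerSumPoly_one a b 0)
    (fun j hj => powerSumPoly_mem_degreeLT a b hj r)
    (fun j hj => powerSumPoly_mem_degreeLT a b hj 0)
    (fun j => powerSumPoly_sub_mem_degreeLT a b j r) (m + 2)).2 m rfl
  unfold constituent at h
  rw [h, sub_self, Polynomial.coeff_zero, coeff_one_powerSumPoly_two_sub a (by omega)] at key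
  have h1 : (0 : ℚ) < (b : ℚ) - a := sub_pos.2 (by exact_mod_cast hab)
  have hb : (0 : ℚ) < b := by exact_mod_cast (by omega : 0 < b)
  have h2 : (0 : ℚ) < (r : ℚ) / b := div_pos (by exact_mod_cast hr0) hb
  have h3 : (0 : ℚ) < 1 - (r : ℚ) / b := sub_pos.2 ((div_lt_one hb).2 (by exact_mod_cast hr))
  have h4 := Nat.factorial_pos m
  have : (0 : ℚ) < ((b : ℚ) - a) * ((r : ℚ) / b * (1 - (r : ℚ) / b)) / (2 * (m.factorial : ℚ)) := by
    positivity
  rw [neg_div] at key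
  linarith

theorem eq_of_eval_multiples {P Q : Polynomial ℚ} {s N : ℕ} (hN : 0 < N)
    (h : ∀ t : ℕ, P.eval ((s + N * t : ℕ) : ℚ) = Q.eval ((s + N * t : ℕ) : ℚ)) : P = Q := by
  refine Polynomial.eq_of_infinite_eval_eq P Q ?_
  refine Set.infinite_of_injective_forall_mem (f := fun t : ℕ => ((s + N * t : ℕ) : ℚ)) ?_ h
  intro t t' e
  have : s + N * t = s + N * t' := Nat.cast_injective (R := ℚ) e
  exact Nat.eq_of_mul_eq_mul_left hN (by omega)

theorem natAbs_eq_one_of_eq {c d : ℤ} (hcd : IsCoprime c d) (h : c.natAbs = d.natAbs) :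
    d.natAbs = 1 := by
  have := Int.isCoprime_iff_gcd_eq_one.1 hcd
  rwa [Int.gcd_def, h, Nat.gcd_self] at this

theorem isQuasipolynomialOfPeriod_max {c d : ℤ} (hcd : IsCoprime c d) {q : ℕ} (hq : 2 ≤ q) :
    IsQuasipolynomialOfPeriod (fun n => countNonattacking (c, d) q n)
      (max c.natAbs d.natAbs) := by
  refine ⟨isQuasipolynomialOfCycle_max hcd q, ?_⟩
  rintro k ⟨hk, P, hP⟩
  have hb := max_natAbs_pos hcd
  have hcount := countNonattacking_eq_eval hcd q
  have hab : min c.natAbs d.natAbs < max c.natAbs d.natAbs ∨ max c.natAbs d.natAbs = 1 := by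
    by_cases h : c.natAbs = d.natAbs
    · right
      rw [h, max_self]
      exact natAbs_eq_one_of_eq hcd h
    · left
      omega
  generalize max c.natAbs d.natAbs = b at *
  generalize min c.natAbs d.natAbs = a at *
  by_contra hlt
  rw [not_le] at hlt
  -- Comparison along the residue classes of `0` and of `k` modulo `k * b`.
  have h0 : constituent a b q 0 = P 0 := by
    refine eq_of_eval_multiples (s := 0) (Nat.mul_pos hk hb) fun t => ?_
    have h1 := hcount (0 + k * b * t)
    have h2 := hP (0 + k * b * t)
    rw [show (0 + k * b * t) % b = 0 by rw [zero_add, mul_assoc, mul_left_comm]; simp] at h1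
    rw [show (0 + k * b * t) % k = 0 by rw [zero_add, mul_assoc]; simp] at h2
    rw [← h1, ← h2]
  have h1 : constituent a b q k = P 0 := by
    refine eq_of_eval_multiples (s := k) (Nat.mul_pos hk hb) fun t => ?_
    have h1 := hcount (k + k * b * t)
    have h2 := hP (k + k * b * t)
    rw [show (k + k * b * t) % b = k by
      rw [mul_assoc, mul_left_comm, Nat.add_mul_mod_self_left, Nat.mod_eq_of_lt hlt]] at h1
    rw [show (k + k * b * t) % k = 0 by rw [mul_assoc]; simp] at h2
    rw [← h1, ← h2]
  exact constituent_ne (hab.resolve_right (by omega)) hq hk hlt (h1.trans h0.symm)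

theorem isQuasipolynomialOfPeriod_one {c d : ℤ} (hcd : IsCoprime c d) :
    IsQuasipolynomialOfPeriod (fun n => countNonattacking (c, d) 1 n) 1 := by
  refine ⟨⟨one_pos, fun _ => Polynomial.X ^ 2, fun n => ?_⟩, fun k hk => hk.1⟩
  have := countNonattacking_eq_eval hcd 1 n
  rwa [constituent, newtonESymm_one, powerSumPoly_one] at this

/-! ### Vertices of the inside-out polytope -/

/-- The linear form of the move hyperplanes for real points. -/
def realLineForm (m : ℤ × ℤ) (z : ℝ × ℝ) : ℝ := z.1 * (m.2 : ℝ) - z.2 * (m.1 : ℝ)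

/-- The coordinate `x` is the coordinate of a facet of the unit square. -/
def IsFacetCoord (x : ℝ) : Prop := x = 0 ∨ x = 1

theorem IsFacetCoord.exists_int {x : ℝ} (h : IsFacetCoord x) : ∃ X : ℤ, x = X ∧ 0 ≤ X ∧ X ≤ 1 := by
  rcases h with rfl | rfl
  · exact ⟨0, by simp⟩
  · exact ⟨1, by simp⟩

/-- A vertex admits no displacement `δ` that stays within all hyperplanes through it. -/
theorem IsInsideOutVertex.displacement_eq_zero {m : ℤ × ℤ} {q : ℕ} {z : Fin q → ℝ × ℝ}
    (hz : IsInsideOutVertex m q z) (δ : Fin q → ℝ × ℝ)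
    (hx : ∀ i, IsFacetCoord (z i).1 → (δ i).1 = 0) (hy : ∀ i, IsFacetCoord (z i).2 → (δ i).2 = 0)
    (hm : ∀ i j, realLineForm m (z i) = realLineForm m (z j) →
      realLineForm m (δ i) = realLineForm m (δ j)) : δ = 0 := by
  obtain ⟨-, S, hS, hSz⟩ := hz
  have hzS : z ∈ ⋂₀ S := by rw [hSz]; rfl
  have : z + δ ∈ ⋂₀ S := by
    intro H hH
    have hzH := hzS H hH
    rcases hS hH with ⟨i, rfl | rfl | rfl | rfl⟩ | ⟨i, j, -, rfl⟩
    · change (z i).1 = 0 at hzH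
      change (z i).1 + (δ i).1 = 0
      rw [hx i (Or.inl hzH), hzH, add_zero]
    · change (z i).1 = 1 at hzH
      change (z i).1 + (δ i).1 = 1
      rw [hx i (Or.inr hzH), hzH, add_zero]
    · change (z i).2 = 0 at hzH
      change (z i).2 + (δ i).2 = 0
      rw [hy i (Or.inl hzH), hzH, add_zero]
    · change (z i).2 = 1 at hzH
      change (z i).2 + (δ i).2 = 1
      rw [hy i (Or.inr hzH), hzH, add_zero]
    · change ((z j).1 - (z i).1) * (m.2 : ℝ) + ((z j).2 - (z i).2) * (-(m.1 : ℝ)) = 0 at hzH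
      change ((z j).1 + (δ j).1 - ((z i).1 + (δ i).1)) * (m.2 : ℝ) +
        ((z j).2 + (δ j).2 - ((z i).2 + (δ i).2)) * (-(m.1 : ℝ)) = 0
      have h := hm i j (by unfold realLineForm; linear_combination -hzH)
      unfold realLineForm at h
      linear_combination hzH - h
  rw [hSz, Set.mem_singleton_iff] at this
  simpa using this

/-- No piece of a vertex can move along its own line. -/
theorem IsInsideOutVertex.facet_of_piece {c d : ℤ} (hcd : IsCoprime c d) {q : ℕ}
    {z : Fin q → ℝ × ℝ} (hz : IsInsideOutVertex (c, d) q z) (i : Fin q) :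
    (c ≠ 0 ∧ IsFacetCoord (z i).1) ∨ (d ≠ 0 ∧ IsFacetCoord (z i).2) := by
  classical
  by_contra! h
  have h0 := hz.displacement_eq_zero (fun j => if j = i then ((c : ℝ), (d : ℝ)) else 0)
    (fun j hj => by
      by_cases e : j = i
      · subst e
        have : c = 0 := by_contra fun hc => h.1 hc hj
        simp [this]
      · simp [e])
    (fun j hj => by
      by_cases e : j = i
      · subst e
        have : d = 0 := by_contra fun hd => h.2 hd hj
        simp [this]
      · simp [e])
    (fun j k _ => by
      have : ∀ j : Fin q, realLineForm (c, d) (if j = i then ((c : ℝ), (d : ℝ)) else 0) = 0 := by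
        intro j
        split_ifs
        · simp only [realLineForm]; ring
        · simp [realLineForm]
      rw [this, this])
  have h1 := congrFun h0 i
  simp at h1
  rw [h1.1, h1.2] at hcd
  exact not_isCoprime_zero_zero hcd

/-- Every piece of a vertex is on a line that passes through a corner `(X, Y)` of the square.
Otherwise every piece on that line (on it by value of the linear form, whichever hyperplanes are
used) could slide along one coordinate axis so as to follow a translation of the line. When the line
is parallel to a side, one of `X`, `Y` has coefficient zero and is chosen arbitrarily. -/
theorem IsInsideOutVertex.exists_corner {c d : ℤ} {q : ℕ} {z : Fin q → ℝ × ℝ}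
    (hz : IsInsideOutVertex (c, d) q z) (i : Fin q) :
    ∃ X Y : ℤ, realLineForm (c, d) (z i) = X * d - Y * c ∧ 0 ≤ X ∧ X ≤ 1 ∧ 0 ≤ Y ∧ Y ≤ 1 := by
  classical
  by_cases h : ∃ j, realLineForm (c, d) (z j) = realLineForm (c, d) (z i) ∧
      (d ≠ 0 → IsFacetCoord (z j).1) ∧ (c ≠ 0 → IsFacetCoord (z j).2)
  · obtain ⟨j, hj, hX, hY⟩ := h
    rw [← hj]
    have hX' : ∃ X : ℤ, (z j).1 * (d : ℝ) = X * d ∧ 0 ≤ X ∧ X ≤ 1 := by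
      by_cases hd : d = 0
      · exact ⟨0, by simp [hd]⟩
      · obtain ⟨X, h1, h2⟩ := (hX hd).exists_int
        exact ⟨X, by rw [h1], h2⟩
    have hY' : ∃ Y : ℤ, (z j).2 * (c : ℝ) = Y * c ∧ 0 ≤ Y ∧ Y ≤ 1 := by
      by_cases hc : c = 0
      · exact ⟨0, by simp [hc]⟩
      · obtain ⟨Y, h1, h2⟩ := (hY hc).exists_int
        exact ⟨Y, by rw [h1], h2⟩
    obtain ⟨X, h1, h2, h3⟩ := hX'
    obtain ⟨Y, h4, h5, h6⟩ := hY'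
    exact ⟨X, Y, by simp only [realLineForm]; rw [h1, h4], h2, h3, h5, h6⟩
  · exfalso
    push Not at h
    have hδ : ∀ j, realLineForm (c, d) (z j) = realLineForm (c, d) (z i) → ∃ δ : ℝ × ℝ,
        (IsFacetCoord (z j).1 → δ.1 = 0) ∧ (IsFacetCoord (z j).2 → δ.2 = 0) ∧
          realLineForm (c, d) δ = 1 := by
      intro j hj
      by_cases h1 : d ≠ 0 → IsFacetCoord (z j).1
      · obtain ⟨hc, hn⟩ := h j hj h1
        have hc' : (c : ℝ) ≠ 0 := by exact_mod_cast hc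
        exact ⟨(0, -1 / c), fun _ => rfl, fun h => absurd h hn, by simp [realLineForm]; field_simp⟩
      · push Not at h1
        have hd' : (d : ℝ) ≠ 0 := by exact_mod_cast h1.1
        exact ⟨(1 / d, 0), fun h => absurd h h1.2, fun _ => rfl, by simp [realLineForm]; field_simp⟩
    choose δ h1 h2 h3 using hδ
    have h0 := hz.displacement_eq_zero
      (fun j => if hj : realLineForm (c, d) (z j) = realLineForm (c, d) (z i) then δ j hj else 0)
      (fun j hj => by
        split_ifs with e
        · exact h1 j e hj
        · rfl)
      (fun j hj => by
        split_ifs with e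
        · exact h2 j e hj
        · rfl)
      (fun j k e => by
        by_cases hj : realLineForm (c, d) (z j) = realLineForm (c, d) (z i)
        · rw [dif_pos hj, dif_pos (e.symm.trans hj), h3, h3]
        · rw [dif_neg hj, dif_neg (fun h => hj (e.trans h))])
    have h4 := congrFun h0 i
    have h5 := h3 i rfl
    simp only [dif_pos] at h4
    rw [h4] at h5
    simp [realLineForm] at h5

/-- On a line through an integral point `(X, Y)` with `0 ≤ Y ≤ 1`, a point with `0 ≤ y ≤ 1` and an
integral coordinate `x` has the other coordinate `y` in `(1 / max |c| |d|) ℤ`: if `|c| < |d|`, the line is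
too steep to reach another integral value of `x`. -/
theorem exists_int_max_mul {c d X Y x : ℤ} {y : ℝ} (hc : c ≠ 0)
    (hy0 : 0 ≤ y) (hy1 : y ≤ 1) (hY0 : 0 ≤ Y) (hY1 : Y ≤ 1)
    (h : (x : ℝ) * d - y * c = X * d - Y * c) :
    ∃ k : ℤ, ((max c.natAbs d.natAbs : ℕ) : ℝ) * y = k := by
  rcases le_or_gt d.natAbs c.natAbs with hle | hlt
  · rw [max_eq_left hle, Nat.cast_natAbs, Int.cast_abs]
    have hy : y * c = ((x * d - X * d + Y * c : ℤ) : ℝ) := by push_cast; linear_combination -h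
    rcases abs_choice (c : ℝ) with e | e
    · exact ⟨x * d - X * d + Y * c, by rw [e, ← hy]; ring⟩
    · exact ⟨-(x * d - X * d + Y * c), by rw [e, Int.cast_neg, ← hy]; ring⟩
  · have hx : x = X := by
      by_contra hne
      have h1 : (y - Y) * c = (x - X : ℤ) * d := by push_cast; linear_combination -h
      have h2 : |y - Y| ≤ 1 := by
        have : (0 : ℝ) ≤ Y := by exact_mod_cast hY0
        have : (Y : ℝ) ≤ 1 := by exact_mod_cast hY1
        rw [abs_le]; constructor <;> linarith
      have h3 : (1 : ℝ) ≤ |((x - X : ℤ) : ℝ)| := by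
        exact_mod_cast Int.one_le_abs (sub_ne_zero.2 hne)
      have h4 : |(c : ℝ)| < |(d : ℝ)| := by
        have : |c| < |d| := by
          rw [Int.abs_eq_natAbs, Int.abs_eq_natAbs]
          exact_mod_cast hlt
        exact_mod_cast this
      have h5 := congrArg abs h1
      rw [abs_mul, abs_mul] at h5
      nlinarith [abs_nonneg (c : ℝ), abs_nonneg (d : ℝ)]
    have hc' : (c : ℝ) ≠ 0 := by exact_mod_cast hc
    have hy : y = Y := by
      rw [hx] at h
      exact mul_right_cancel₀ hc' (by linear_combination -h)
    exact ⟨(max c.natAbs d.natAbs : ℕ) * Y, by rw [hy, Int.cast_mul, Int.cast_natCast]⟩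

theorem IsInsideOutVertex.max_mul_integral {c d : ℤ} (hcd : IsCoprime c d) {q : ℕ}
    {z : Fin q → ℝ × ℝ} (hz : IsInsideOutVertex (c, d) q z) (i : Fin q) :
    ∃ k l : ℤ, ((max c.natAbs d.natAbs : ℕ) : ℝ) * (z i).1 = k ∧
      ((max c.natAbs d.natAbs : ℕ) : ℝ) * (z i).2 = l := by
  obtain ⟨X, Y, h, hX0, hX1, hY0, hY1⟩ := hz.exists_corner i
  simp only [realLineForm] at h
  obtain ⟨hx, hy⟩ := hz.1 i
  rcases hz.facet_of_piece hcd i with ⟨hc, hf⟩ | ⟨hd, hf⟩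
  · obtain ⟨x, hxi, -⟩ := hf.exists_int
    rw [hxi] at h
    obtain ⟨l, hl⟩ := exists_int_max_mul hc hy.1 hy.2 hY0 hY1 h
    exact ⟨(max c.natAbs d.natAbs : ℕ) * x, l, by rw [hxi, Int.cast_mul, Int.cast_natCast], hl⟩
  · obtain ⟨y, hyi, -⟩ := hf.exists_int
    rw [hyi] at h
    obtain ⟨k, hk⟩ := exists_int_max_mul (c := d) (d := c) (X := Y) (Y := X) (x := y) hd hx.1 hx.2
      hX0 hX1 (by linear_combination -h)
    refine ⟨k, (max c.natAbs d.natAbs : ℕ) * y, ?_, by rw [hyi, Int.cast_mul, Int.cast_natCast]⟩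
    rwa [max_comm] at hk

/-- A point with an integral multiple has a denominator, and it divides the multiplier. -/
theorem exists_isPointDenominator_dvd {q : ℕ} {z : Fin q → ℝ × ℝ} {b : ℕ} (hb : 0 < b)
    (h : ∀ i, ∃ k l : ℤ, (b : ℝ) * (z i).1 = k ∧ (b : ℝ) * (z i).2 = l) :
    ∃ N, IsPointDenominator z N ∧ N ∣ b := by
  classical
  have hex : ∃ k : ℕ, 0 < k ∧
    ∀ i, ∃ a b : ℤ, (k : ℝ) * (z i).1 = (a : ℝ) ∧ (k : ℝ) * (z i).2 = (b : ℝ) := ⟨b, hb, h⟩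
  have hleast : IsPointDenominator z (Nat.find hex) :=
    ⟨Nat.find_spec hex, fun k hk => Nat.find_min' hex hk⟩
  refine ⟨_, hleast, ?_⟩
  generalize Nat.find hex = N at hleast
  obtain ⟨⟨hN, hNz⟩, hmin⟩ := hleast
  by_contra hnd
  have hpos : 0 < b % N := Nat.pos_of_ne_zero fun h0 => hnd (Nat.dvd_of_mod_eq_zero h0)
  refine absurd (hmin ⟨hpos, fun i => ?_⟩) (not_le.2 (Nat.mod_lt b hN))
  obtain ⟨k, l, hk, hl⟩ := h i
  obtain ⟨u, v, hu, hv⟩ := hNz i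
  have hmod : ((b % N : ℕ) : ℝ) = b - N * (b / N : ℕ) := by
    rw [eq_sub_iff_add_eq]
    exact_mod_cast Nat.mod_add_div b N
  refine ⟨k - (b / N : ℕ) * u, l - (b / N : ℕ) * v, ?_, ?_⟩
  · rw [hmod, Int.cast_sub, Int.cast_mul, Int.cast_natCast, ← hk, ← hu]; ring
  · rw [hmod, Int.cast_sub, Int.cast_mul, Int.cast_natCast, ← hl, ← hv]; ring

/-! ### A vertex of the largest denominator -/

/-- All pieces but one on a corner `P` of the square, and one at a point `Q` of a side on the line
through `P`, form a vertex when that line crosses the side. -/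
theorem isInsideOutVertex_update {c d : ℤ} {q : ℕ} (i j : Fin q) (hij : i ≠ j) {P Q : ℝ × ℝ}
    (hP1 : IsFacetCoord P.1) (hP2 : IsFacetCoord P.2)
    (hQ : (IsFacetCoord Q.2 ∧ d ≠ 0) ∨ (IsFacetCoord Q.1 ∧ c ≠ 0))
    (hQ1 : Q.1 ∈ Set.Icc (0 : ℝ) 1) (hQ2 : Q.2 ∈ Set.Icc (0 : ℝ) 1)
    (hline : (Q.1 - P.1) * (d : ℝ) + (Q.2 - P.2) * (-(c : ℝ)) = 0) :
    IsInsideOutVertex (c, d) q (Function.update (fun _ => P) j Q) := by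
  have hIcc : ∀ {x : ℝ}, IsFacetCoord x → x ∈ Set.Icc (0 : ℝ) 1 := by
    rintro x (rfl | rfl) <;> simp
  set z : Fin q → ℝ × ℝ := Function.update (fun _ => P) j Q with hz
  have hzj : z j = Q := Function.update_self ..
  have hzk : ∀ k, k ≠ j → z k = P := fun k hk => Function.update_of_ne hk ..
  refine ⟨fun k => ?_, {H | H ∈ facetHyperplanes q ∪ moveArrangement (c, d) q ∧ z ∈ H},
    fun H hH => hH.1, ?_⟩
  · by_cases hk : k = j
    · rw [hk, hzj]; exact ⟨hQ1, hQ2⟩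
    · rw [hzk k hk]; exact ⟨hIcc hP1, hIcc hP2⟩
  · ext w
    rw [Set.mem_singleton_iff]
    constructor
    swap
    · rintro rfl H hH
      exact hH.2
    intro hw
    have fst_eq : ∀ k, IsFacetCoord (z k).1 → (w k).1 = (z k).1 := by
      rintro k (h | h)
      · rw [h]; exact hw {z | (z k).1 = 0} ⟨Or.inl ⟨k, Or.inl rfl⟩, h⟩
      · rw [h]; exact hw {z | (z k).1 = 1} ⟨Or.inl ⟨k, Or.inr (Or.inl rfl)⟩, h⟩
    have snd_eq : ∀ k, IsFacetCoord (z k).2 → (w k).2 = (z k).2 := by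
      rintro k (h | h)
      · rw [h]; exact hw {z | (z k).2 = 0} ⟨Or.inl ⟨k, Or.inr (Or.inr (Or.inl rfl))⟩, h⟩
      · rw [h]; exact hw {z | (z k).2 = 1} ⟨Or.inl ⟨k, Or.inr (Or.inr (Or.inr rfl))⟩, h⟩
    have hwk : ∀ k, k ≠ j → w k = P := by
      intro k hk
      have h1 := fst_eq k (by rwa [hzk k hk])
      have h2 := snd_eq k (by rwa [hzk k hk])
      rw [hzk k hk] at h1 h2
      exact Prod.ext h1 h2
    have hmove : ((w j).1 - (w i).1) * (d : ℝ) + ((w j).2 - (w i).2) * (-(c : ℝ)) = 0 :=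
      hw _ ⟨Or.inr ⟨i, j, hij, rfl⟩, by
        change ((z j).1 - (z i).1) * (d : ℝ) + ((z j).2 - (z i).2) * (-(c : ℝ)) = 0
        rw [hzj, hzk i hij]; exact hline⟩
    rw [hwk i hij] at hmove
    funext k
    by_cases hk : k = j
    · subst hk
      rw [hzj]
      rcases hQ with ⟨hQf, hd⟩ | ⟨hQf, hc⟩
      · have h2 := snd_eq k (by rwa [hzj])
        rw [hzj] at h2
        have hd' : (d : ℝ) ≠ 0 := by exact_mod_cast hd
        rw [h2] at hmove
        exact Prod.ext (mul_right_cancel₀ hd' (by linear_combination hmove - hline)) h2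
      · have h1 := fst_eq k (by rwa [hzj])
        rw [hzj] at h1
        have hc' : (c : ℝ) ≠ 0 := by exact_mod_cast hc
        rw [h1] at hmove
        exact Prod.ext h1 (mul_right_cancel₀ hc' (by linear_combination hline - hmove))
    · rw [hwk k hk, hzk k hk]

/-- For `|c| ≤ |d|` the line of direction `(c, d)` through one of the corners `(x, 0)` of the unit
square meets the opposite side, at the point `(x + c / d, 1)`. The sign of `c / d` selects `x`. -/
theorem exists_corner_add_div_mem_Icc {c d : ℤ} (h : c.natAbs ≤ d.natAbs) :
    ∃ x : ℤ, IsFacetCoord (x : ℝ) ∧ (x : ℝ) + (c : ℝ) / d ∈ Set.Icc (0 : ℝ) 1 := by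
  have h1 : |(c : ℝ) / d| ≤ 1 := by
    rw [abs_div]
    refine div_le_one_of_le₀ ?_ (abs_nonneg _)
    have : |c| ≤ |d| := by
      rw [Int.abs_eq_natAbs, Int.abs_eq_natAbs]
      exact_mod_cast h
    exact_mod_cast this
  rw [abs_le] at h1
  rcases le_total 0 ((c : ℝ) / d) with h0 | h0
  · exact ⟨0, Or.inl (by simp), by simpa using ⟨h0, h1.2⟩⟩
  · exact ⟨1, Or.inr (by simp), by rw [Set.mem_Icc]; push_cast; constructor <;> linarith⟩

theorem natAbs_dvd_of_mul_add_div {c d x k : ℤ} {N : ℕ} (hcd : IsCoprime c d) (hd : d ≠ 0)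
    (h : (N : ℝ) * ((x : ℝ) + (c : ℝ) / d) = k) : d.natAbs ∣ N := by
  have hd' : (d : ℝ) ≠ 0 := by exact_mod_cast hd
  have e : (N : ℤ) * c = d * (k - N * x) := by
    have : (N : ℝ) * c = d * (k - N * x) := by
      rw [← h]
      field_simp
      ring
    exact_mod_cast this
  have : d ∣ (N : ℤ) := hcd.symm.dvd_of_dvd_mul_right ⟨_, e⟩
  exact Int.natAbs_dvd_natAbs.2 this

/-- Some vertex has a denominator that is a multiple of `max |c| |d|`. -/
theorem exists_vertex_max_dvd {c d : ℤ} (hcd : IsCoprime c d) {q : ℕ} (hq : 2 ≤ q) :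
    ∃ z : Fin q → ℝ × ℝ, IsInsideOutVertex (c, d) q z ∧
      ∀ N, IsPointDenominator z N → max c.natAbs d.natAbs ∣ N := by
  have hij : (⟨0, by omega⟩ : Fin q) ≠ ⟨1, by omega⟩ := by simp
  have hpos := max_natAbs_pos hcd
  rcases le_total c.natAbs d.natAbs with hle | hle
  · rw [max_eq_right hle] at hpos ⊢
    have hd : d ≠ 0 := by omega
    have hd' : (d : ℝ) ≠ 0 := by exact_mod_cast hd
    obtain ⟨x, hx, hmem⟩ := exists_corner_add_div_mem_Icc hle
    refine ⟨_, isInsideOutVertex_update _ _ hij (P := ((x : ℝ), 0))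
      (Q := ((x : ℝ) + (c : ℝ) / d, 1)) hx (Or.inl rfl) (Or.inl ⟨Or.inr rfl, hd⟩) hmem
      (by simp) (by field_simp; ring), ?_⟩
    intro N hN
    obtain ⟨k, -, hk, -⟩ := hN.1.2 ⟨1, by omega⟩
    rw [Function.update_self] at hk
    exact natAbs_dvd_of_mul_add_div hcd hd hk
  · rw [max_eq_left hle] at hpos ⊢
    have hc : c ≠ 0 := by omega
    have hc' : (c : ℝ) ≠ 0 := by exact_mod_cast hc
    obtain ⟨y, hy, hmem⟩ := exists_corner_add_div_mem_Icc hle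
    refine ⟨_, isInsideOutVertex_update _ _ hij (P := (0, (y : ℝ)))
      (Q := (1, (y : ℝ) + (d : ℝ) / c)) (Or.inl rfl) hy (Or.inr ⟨Or.inr rfl, hc⟩)
      (by simp) hmem (by field_simp; ring), ?_⟩
    intro N hN
    obtain ⟨-, k, -, hk⟩ := hN.1.2 ⟨1, by omega⟩
    rw [Function.update_self] at hk
    exact natAbs_dvd_of_mul_add_div hcd.symm hc hk

theorem isInsideOutDenominator_max {c d : ℤ} (hcd : IsCoprime c d) {q : ℕ} (hq : 2 ≤ q) :
    IsInsideOutDenominator (c, d) q (max c.natAbs d.natAbs) := by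
  refine ⟨⟨max_natAbs_pos hcd, fun z hz =>
    exists_isPointDenominator_dvd (max_natAbs_pos hcd) (hz.max_mul_integral hcd)⟩, ?_⟩
  rintro k ⟨hk, h⟩
  obtain ⟨z, hz, hdvd⟩ := exists_vertex_max_dvd hcd hq
  obtain ⟨N, hN, hNk⟩ := h z hz
  exact Nat.le_of_dvd hk ((hdvd N hN).trans hNk)

/-- A single piece has no move hyperplanes, so that the vertices are the corners of the square. -/
theorem isInsideOutDenominator_one (m : ℤ × ℤ) : IsInsideOutDenominator m 1 1 := by
  refine ⟨⟨one_pos, fun z hz => exists_isPointDenominator_dvd one_pos fun i => ?_⟩, fun k hk => hk.1⟩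
  classical
  -- With one piece every displacement of the coordinates not in `{0, 1}` is allowed.
  have h0 := hz.displacement_eq_zero
    (fun i => (if IsFacetCoord (z i).1 then 0 else 1, if IsFacetCoord (z i).2 then 0 else 1))
    (fun i hi => by simp [hi]) (fun i hi => by simp [hi])
    (fun i j _ => by rw [Subsingleton.elim i j])
  have h1 := congrFun h0 i
  simp only [Pi.zero_apply, Prod.mk_eq_zero, ite_eq_left_iff, one_ne_zero, imp_false, not_not] at h1
  obtain ⟨x, hx, -⟩ := h1.1.exists_int
  obtain ⟨y, hy, -⟩ := h1.2.exists_int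
  exact ⟨x, y, by simp [hx], by simp [hy]⟩

theorem theoremT (c d : ℤ) (hcd : IsCoprime c d) (q : ℕ) (hq : 1 ≤ q) :
    (2 ≤ q →
      IsQuasipolynomialOfPeriod (fun n => countNonattacking (c, d) q n) (max c.natAbs d.natAbs)) ∧
    ∃ p : ℕ, IsQuasipolynomialOfPeriod (fun n => countNonattacking (c, d) q n) p ∧
      IsInsideOutDenominator (c, d) q p := by
  refine ⟨isQuasipolynomialOfPeriod_max hcd, ?_⟩
  rcases hq.eq_or_lt with rfl | hq
  · exact ⟨1, isQuasipolynomialOfPeriod_one hcd, isInsideOutDenominator_one _⟩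
  · exact ⟨_, isQuasipolynomialOfPeriod_max hcd hq, isInsideOutDenominator_max hcd hq⟩
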